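/- For $p>0$ and $x\in(0,\pi/2)$ let $$\varphi_p(x)=-\frac{\sin x}{x}+\frac{\cos x+2}{3}-\frac{1}{180}x^4+p\,x^6,$$ and let $A=\dfrac{\pi^5-1920\pi+5760}{45\pi^7}=0.00025135\ldots$ and $B=\dfrac1{3780}=0.00026455\ldots$ (here and below, $\ldots$ means that the displayed decimal expansion is truncated). For every $p\in(A,B)$ the function $\varphi_p$ has exactly one extremum $t^{(p)}$ on $(0,\pi/2)$, which is its minimum on that interval, and the limit $\varphi_p(\pi/2-)=\lim_{x\to\pi/2-}\varphi_p(x)$ exists in $\mathbb R$. (iv) The equation $$\bigl|\varphi_p(t^{(p)})\bigr|=\varphi_p\!\left(\tfrac{\pi}{2}-\right)$$ has exactly one solution $p_0$ in $(A,B)$, and $p_0=0.00025234\ldots$. The value $$d_0=\bigl|\varphi_{p_0}(t^{(p_0)})\bigr|=\varphi_{p_0}\!\left(\tfrac{\pi}{2}-\right)=0.000014887\ldots$$ satisfies $$d_0=\inf_{p>0}\ \sup_{x\in(0,\pi/2)}|\varphi_p(x)|.$$ (v) The function $\varphi_{p_0}$ is the minimax approximant of the family on $(0,\pi/2)$, that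 is, $p_0$ is the unique parameter $p>0$ at which the infimum $\inf_{p>0}\sup_{x\in(0,\pi/2)}|\varphi_p(x)|$ is attained. The corresponding minimax approximation $$\frac{\sin x}{x}-\frac{\cos x+2}{3}\approx-\frac1{180}x^4+p_0x^6$$ has error exactly $d_0$: $$\sup_{x\in(0,\pi/2)}\left|\frac{\sin x}{x}-\frac{\cos x+2}{3}-\left(-\frac1{180}x^4+p_0x^6\right)\right|=d_0.$$ -/

import Mathlib

open Set Filter Topology

namespace CusaHuygens

/-- The family `φ_p(x) = -sin x / x + (cos x + 2) / 3 - x⁴ / 180 + p x⁶`, considered for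
`x ∈ (0, π/2)` and parameters `p > 0`. -/
noncomputable def phi (p x : ℝ) : ℝ :=
  -(Real.sin x / x) + (Real.cos x + 2) / 3 - 1 / 180 * x ^ 4 + p * x ^ 6

/-- `A = (π⁵ - 1920 π + 5760) / (45 π⁷)`. -/
noncomputable def A : ℝ :=
  (Real.pi ^ 5 - 1920 * Real.pi + 5760) / (45 * Real.pi ^ 7)

/-- `B = 1 / 3780`. -/
noncomputable def B : ℝ := 1 / 3780

/-- `t` is the only (local) extremum of `f` on the open interval `(a, b)`, and `f` attains its
minimum over `(a, b)` at `t`. -/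
def IsSoleMinimum (f : ℝ → ℝ) (a b t : ℝ) : Prop :=
  t ∈ Ioo a b ∧ IsMinOn f (Ioo a b) t ∧ ∀ s ∈ Ioo a b, IsLocalExtr f s → s = t

/-- The error `sup_{x ∈ (a, b)} |f x|`, with values in the extended reals, so that it is `⊤` for
an unbounded function. -/
noncomputable def error (f : ℝ → ℝ) (a b : ℝ) : EReal :=
  ⨆ x ∈ Ioo a b, ((|f x| : ℝ) : EReal)

/-- The smallest error in the family, `inf_{p > 0} sup_{x ∈ (a, b)} |φ_p x|`. -/
noncomputable def minimaxError (φ : ℝ → ℝ → ℝ) (a b : ℝ) : EReal :=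
  ⨅ p ∈ Ioi (0 : ℝ), error (φ p) a b

/-- `φ_{p₀}` is the minimax approximant of the family `φ` on `(a, b)`: `p₀` is the unique
positive parameter at which the infimum of the error is attained. -/
def IsMinimaxApproximant (φ : ℝ → ℝ → ℝ) (a b p₀ : ℝ) : Prop :=
  0 < p₀ ∧ error (φ p₀) a b = minimaxError φ a b ∧
    ∀ p, 0 < p → error (φ p) a b = minimaxError φ a b → p = p₀

end CusaHuygens

namespace CusaHuygens

/-! Write `φ_p' = x⁵ (H + 6p)` with `H = slope`. Since `H` is strictly increasing and, for `A < p <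
B`, `H + 6p` changes sign, `φ_p` falls from its limit 0 to a negative minimum and then rises to `(p
- A)(π/2)⁶ > 0`. Both extreme values increase strictly and continuously with `p`, so their sum has
exactly one zero `p₀`, bracketed numerically. There the error equioscillates, and as `φ_q - φ_p = (q
- p) x⁶` has constant sign, any other parameter worsens one of the two extremes
(`error_lt_of_equioscillation`). -/

/-! ### Taylor bounds for sine and cosine -/

open Finset in
theorem cos_sin_taylor_alternating (n : ℕ) :
    (∀ x : ℝ, 0 ≤ x → 0 ≤ (-1) ^ (n + 1) *
      (Real.cos x - ∑ k ∈ range (n + 1), (-1) ^ k * x ^ (2 * k) / (2 * k).factorial)) ∧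
    (∀ x : ℝ, 0 ≤ x → 0 ≤ (-1) ^ (n + 1) *
      (Real.sin x - ∑ k ∈ range (n + 1), (-1) ^ k * x ^ (2 * k + 1) / (2 * k + 1).factorial)) := by
  -- Each remainder is an antiderivative of the preceding one and vanishes at 0, so signs propagate
  -- from `cos x ≤ 1`.
  have integrate : ∀ {f f' : ℝ → ℝ}, (∀ x, HasDerivAt f (f' x) x) → f 0 = 0 →
      (∀ x, 0 ≤ x → 0 ≤ f' x) → ∀ x, 0 ≤ x → 0 ≤ f x := by
    intro f f' hf h0 hf' x hx
    have hmono : MonotoneOn f (Ici 0) := by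
      refine monotoneOn_of_deriv_nonneg (convex_Ici 0)
        (fun y _ => (hf y).continuousAt.continuousWithinAt)
        (fun y _ => (hf y).differentiableAt.differentiableWithinAt) fun y hy => ?_
      rw [interior_Ici] at hy
      rw [(hf y).deriv]
      exact hf' y (le_of_lt hy)
    simpa [h0] using hmono (mem_Ici.2 le_rfl) (mem_Ici.2 hx) hx
  have dpow : ∀ (c : ℝ) (m : ℕ) (x : ℝ),
      HasDerivAt (fun x : ℝ => c * x ^ (m + 1) / (m + 1).factorial)
        (c * x ^ m / m.factorial) x := by
    intro c m x
    refine (((hasDerivAt_pow (m + 1) x).const_mul c).div_const ((m + 1).factorial : ℝ)).congr_deriv ?_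
    have := Nat.factorial_ne_zero m
    have h : (m : ℝ) + 1 ≠ 0 := by positivity
    rw [Nat.factorial_succ]
    push_cast
    field_simp
  have dsin : ∀ (n : ℕ) (x : ℝ), HasDerivAt (fun x => (-1) ^ (n + 1) *
      (Real.sin x - ∑ k ∈ range (n + 1), (-1) ^ k * x ^ (2 * k + 1) / (2 * k + 1).factorial))
      ((-1) ^ (n + 1) *
      (Real.cos x - ∑ k ∈ range (n + 1), (-1) ^ k * x ^ (2 * k) / (2 * k).factorial)) x :=
    fun n x => ((Real.hasDerivAt_sin x).sub
      (HasDerivAt.fun_sum fun k _ => dpow ((-1) ^ k) (2 * k) x)).const_mul _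
  have dcos : ∀ (n : ℕ) (x : ℝ), HasDerivAt (fun x => (-1) ^ (n + 2) *
      (Real.cos x - ∑ k ∈ range (n + 2), (-1) ^ k * x ^ (2 * k) / (2 * k).factorial))
      ((-1) ^ (n + 1) *
      (Real.sin x - ∑ k ∈ range (n + 1), (-1) ^ k * x ^ (2 * k + 1) / (2 * k + 1).factorial))
      x := by
    intro n x
    simp only [sum_range_succ' _ (n + 1)]
    have h := ((Real.hasDerivAt_cos x).sub
      ((HasDerivAt.fun_sum (u := range (n + 1)) fun k _ =>
        dpow ((-1) ^ (k + 1)) (2 * k + 1) x).add_const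
        ((-1) ^ 0 * x ^ (2 * 0) / ((2 * 0).factorial : ℝ)))).const_mul ((-1 : ℝ) ^ (n + 2))
    refine h.congr_deriv ?_
    have : ∀ k : ℕ, (-1 : ℝ) ^ (k + 1) * x ^ (2 * k + 1) / (2 * k + 1).factorial =
        -((-1) ^ k * x ^ (2 * k + 1) / (2 * k + 1).factorial) := fun k => by ring
    simp only [this, sum_neg_distrib]
    ring
  have hs : ∀ n : ℕ, (∀ x : ℝ, 0 ≤ x → 0 ≤ (-1) ^ (n + 1) *
      (Real.cos x - ∑ k ∈ range (n + 1), (-1) ^ k * x ^ (2 * k) / (2 * k).factorial)) →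
      ∀ x : ℝ, 0 ≤ x → 0 ≤ (-1) ^ (n + 1) *
      (Real.sin x - ∑ k ∈ range (n + 1), (-1) ^ k * x ^ (2 * k + 1) / (2 * k + 1).factorial) :=
    fun n h => integrate (dsin n) (by simp) h
  induction n with
  | zero =>
    have h : ∀ x : ℝ, 0 ≤ x → 0 ≤ (-1) ^ (0 + 1) *
      (Real.cos x - ∑ k ∈ range (0 + 1), (-1) ^ k * x ^ (2 * k) / (2 * k).factorial) := by
      intro x _
      simpa using Real.cos_le_one x
    exact ⟨h, hs 0 h⟩
  | succ n ih =>
    have h := integrate (dcos n) (by simp [sum_range_succ']) ih.2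
    exact ⟨h, hs (n + 1) h⟩

/-! ### Monotonicity and signs of the slope -/

/-- The function `H` with `φ_p'(x) = x⁵ (H x + 6 p)`. -/
noncomputable def slope (x : ℝ) : ℝ :=
  -(Real.cos x / x ^ 6) + Real.sin x / x ^ 7 - Real.sin x / (3 * x ^ 5) - 1 / (45 * x ^ 2)

theorem hasDerivAt_phi (p : ℝ) {x : ℝ} (hx : 0 < x) :
    HasDerivAt (phi p) (x ^ 5 * (slope x + 6 * p)) x := by
  have h := (((((Real.hasDerivAt_sin x).div (hasDerivAt_id x) hx.ne').neg).add
    (((Real.hasDerivAt_cos x).add_const 2).div_const 3)).sub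
    ((hasDerivAt_pow 4 x).const_mul (1 / 180))).add ((hasDerivAt_pow 6 x).const_mul p)
  refine h.congr_deriv ?_
  unfold slope
  simp only [id]
  field_simp
  ring

theorem hasDerivAt_slope {x : ℝ} (hx : 0 < x) :
    HasDerivAt slope ((Real.sin x * (8 / 3 * x ^ 2 - 7) + Real.cos x * (7 * x - x ^ 3 / 3)
      + 2 / 45 * x ^ 5) / x ^ 8) x := by
  have hx' := hx.ne'
  have h := (((((Real.hasDerivAt_cos x).div (hasDerivAt_pow 6 x) (by positivity)).neg).add
    ((Real.hasDerivAt_sin x).div (hasDerivAt_pow 7 x) (by positivity))).sub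
    ((Real.hasDerivAt_sin x).div ((hasDerivAt_pow 5 x).const_mul 3) (by positivity))).sub
    ((hasDerivAt_const x (1 : ℝ)).div ((hasDerivAt_pow 2 x).const_mul 45) (by positivity))
  refine h.congr_deriv ?_
  field_simp
  ring

theorem sin_le_taylor_nine {x : ℝ} (hx : 0 ≤ x) :
    Real.sin x ≤ x - x ^ 3 / 6 + x ^ 5 / 120 - x ^ 7 / 5040 + x ^ 9 / 362880 := by
  have h := (cos_sin_taylor_alternating 4).2 x hx
  simp only [Finset.sum_range_succ, Finset.sum_range_zero, Nat.factorial] at h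
  norm_num at h
  linarith

theorem taylor_ten_le_cos {x : ℝ} (hx : 0 ≤ x) :
    1 - x ^ 2 / 2 + x ^ 4 / 24 - x ^ 6 / 720 + x ^ 8 / 40320 - x ^ 10 / 3628800
      ≤ Real.cos x := by
  have h := (cos_sin_taylor_alternating 5).1 x hx
  simp only [Finset.sum_range_succ, Finset.sum_range_zero, Nat.factorial] at h
  norm_num at h
  linarith

/-- In the Taylor bound all terms below `x⁹` cancel, leaving `x⁹ / 11340` to dominate a small
negative `x¹¹` term. -/
theorem slope_deriv_numerator_pos {x : ℝ} (hx : 0 < x) (hx' : x < Real.pi / 2) :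
    0 < Real.sin x * (8 / 3 * x ^ 2 - 7) + Real.cos x * (7 * x - x ^ 3 / 3)
      + 2 / 45 * x ^ 5 := by
  have hpi := Real.pi_lt_d2
  -- 2.6 lies between `π²/4` and 21/8, where `8/3 x² - 7` changes sign.
  have h2 : x ^ 2 < 2.6 := by nlinarith
  have hs := mul_le_mul_of_nonneg_right (sin_le_taylor_nine hx.le)
    (show 0 ≤ 7 - 8 / 3 * x ^ 2 by linarith)
  have hc := mul_le_mul_of_nonneg_right (taylor_ten_le_cos hx.le)
    (show 0 ≤ 7 * x - x ^ 3 / 3 by nlinarith)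
  have key : 0 < x ^ 9 * (1 / 11340 - x ^ 2 * (1 / 100000)) := by
    have : 0 < 1 / 11340 - x ^ 2 * (1 / 100000) := by linarith
    positivity
  have h11 : 0 < x ^ 11 := by positivity
  have h13 : 0 < x ^ 13 := by positivity
  nlinarith

theorem strictMonoOn_slope : StrictMonoOn slope (Ioc 0 (Real.pi / 2)) := by
  refine strictMonoOn_of_deriv_pos (convex_Ioc _ _)
    (fun x hx => (hasDerivAt_slope hx.1).continuousAt.continuousWithinAt) fun x hx => ?_
  rw [interior_Ioc] at hx
  rw [(hasDerivAt_slope hx.1).deriv]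
  exact div_pos (slope_deriv_numerator_pos hx.1 hx.2) (pow_pos hx.1 8)

/-- Near 0, `slope x + 6p = 6(p - B) + O(x²)`; the choice `x = B - p` makes this `-6x + O(x²)`. -/
theorem slope_add_neg {p x : ℝ} (hp : 0 < p) (hp' : p < B) (hx : x = B - p) :
    slope x + 6 * p < 0 := by
  have hx0 : 0 < x := by linarith
  have hx1 : x < 1 / 3780 := by unfold B at hx; linarith
  have hs := mul_le_mul_of_nonneg_right (sin_le_taylor_nine hx0.le)
    (show 0 ≤ 1 - x ^ 2 / 3 by nlinarith)
  have hc := mul_le_mul_of_nonneg_right (taylor_ten_le_cos hx0.le) hx0.le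
  have hxn := hx0.ne'
  have e : slope x + 6 * p = (Real.sin x * (1 - x ^ 2 / 3) - Real.cos x * x - x ^ 5 / 45
      + 6 * p * x ^ 7) / x ^ 7 := by
    unfold slope
    field_simp
    ring
  rw [e]
  refine div_neg_of_neg_of_pos ?_ (by positivity)
  have hpx : p = 1 / 3780 - x := by unfold B at hx; linarith
  rw [hpx]
  have h8 : 0 < x ^ 8 := by positivity
  have h11 : 0 < x ^ 11 := by positivity
  have h9 : x ^ 9 < x ^ 8 := by
    have : x ^ 9 = x ^ 8 * x := by ring
    nlinarith
  have h11' : x ^ 11 < x ^ 8 := by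
    exact pow_lt_pow_right_of_lt_one₀ hx0 (by linarith) (by norm_num)
  nlinarith

/-! ### Boundary values and shape of `φ_p` -/

theorem leftLim_phi (p : ℝ) :
    Tendsto (phi p) (𝓝[<] (Real.pi / 2)) (𝓝 (phi p (Real.pi / 2))) ∧
      Function.leftLim (phi p) (Real.pi / 2) = phi p (Real.pi / 2) := by
  have h : Tendsto (phi p) (𝓝[<] (Real.pi / 2)) (𝓝 (phi p (Real.pi / 2))) :=
    (hasDerivAt_phi p Real.pi_div_two_pos).continuousAt.tendsto.mono_left nhdsWithin_le_nhds
  exact ⟨h, leftLim_eq_of_tendsto h⟩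

theorem phi_pi_div_two (p : ℝ) : phi p (Real.pi / 2) = (p - A) * (Real.pi / 2) ^ 6 := by
  have := Real.pi_ne_zero
  unfold phi A
  rw [Real.sin_pi_div_two, Real.cos_pi_div_two]
  field_simp
  ring

theorem phi_sub_phi (p q x : ℝ) : phi q x = phi p x + (q - p) * x ^ 6 := by
  unfold phi
  ring

theorem tendsto_phi_zero (p : ℝ) : Tendsto (phi p) (𝓝[>] 0) (𝓝 0) := by
  have hc : Continuous fun x : ℝ =>
      -Real.sinc x + (Real.cos x + 2) / 3 - 1 / 180 * x ^ 4 + p * x ^ 6 := by fun_prop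
  have h := (hc.tendsto 0).mono_left (nhdsWithin_le_nhds (s := Ioi 0))
  norm_num at h
  refine h.congr' ?_
  filter_upwards [self_mem_nhdsWithin] with x hx
  rw [Real.sinc_of_ne_zero (ne_of_gt hx)]
  unfold phi
  ring

theorem pi_pow_bounds (n : ℕ) :
    (3.14159265358979323846 : ℝ) ^ n ≤ Real.pi ^ n ∧
      Real.pi ^ n ≤ (3.14159265358979323847 : ℝ) ^ n :=
  ⟨pow_le_pow_left₀ (by norm_num) Real.pi_gt_d20.le n,
    pow_le_pow_left₀ Real.pi_pos.le Real.pi_lt_d20.le n⟩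

theorem slope_pi_div_two_pos {p : ℝ} (hp : A < p) : 0 < slope (Real.pi / 2) + 6 * p := by
  suffices h : 0 < slope (Real.pi / 2) + 6 * A by linarith
  have := Real.pi_ne_zero
  have e : slope (Real.pi / 2) + 6 * A =
      (896 - 256 * Real.pi - 32 / 3 * Real.pi ^ 2 + 2 / 45 * Real.pi ^ 5) / Real.pi ^ 7 := by
    unfold slope A
    rw [Real.sin_pi_div_two, Real.cos_pi_div_two]
    field_simp
    ring
  rw [e]
  have h2 := (pi_pow_bounds 2).2
  have h5 := (pi_pow_bounds 5).1
  have h1 := Real.pi_lt_d20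
  norm_num at h1 h2 h5
  exact div_pos (by linarith) (by positivity)

theorem A_bounds : 0.00025135006 < A ∧ A < 0.00025135007 := by
  have h1 := pi_pow_bounds 1
  have h5 := pi_pow_bounds 5
  have h7 := pi_pow_bounds 7
  norm_num at h1 h5 h7
  unfold A
  constructor
  · rw [lt_div_iff₀ (by positivity)]
    linarith
  · rw [div_lt_iff₀ (by positivity)]
    linarith

theorem exists_isSoleMinimum {p : ℝ} (hp : p ∈ Ioo A B) :
    ∃ t, IsSoleMinimum (phi p) 0 (Real.pi / 2) t ∧ phi p t < 0 ∧
      ∀ x ∈ Ioo 0 (Real.pi / 2), phi p x ≤ phi p (Real.pi / 2) := by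
  have hp0 : 0 < p := by linarith [A_bounds.1, hp.1]
  have hpi := Real.pi_gt_three
  have hB : B < 1 := by norm_num [B]
  have hx0 : 0 < B - p := sub_pos.2 hp.2
  have hcont : ContinuousOn (fun x => slope x + 6 * p) (Icc (B - p) (Real.pi / 2)) := fun x hx =>
    ((hasDerivAt_slope (hx0.trans_le hx.1)).continuousAt.add continuousAt_const).continuousWithinAt
  obtain ⟨t, ht, ht0⟩ := intermediate_value_Ioo (by linarith) hcont
    ⟨slope_add_neg hp0 hp.2 rfl, slope_pi_div_two_pos hp.1⟩
  simp only at ht0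
  have htpos : 0 < t := hx0.trans ht.1
  have hneg : ∀ x ∈ Ioo 0 t, x ^ 5 * (slope x + 6 * p) < 0 := fun x hx =>
    mul_neg_of_pos_of_neg (pow_pos hx.1 5) (by
      linarith [strictMonoOn_slope ⟨hx.1, hx.2.le.trans ht.2.le⟩ ⟨htpos, ht.2.le⟩ hx.2])
  have hpos : ∀ x ∈ Ioc t (Real.pi / 2), 0 < x ^ 5 * (slope x + 6 * p) := fun x hx =>
    mul_pos (pow_pos (htpos.trans hx.1) 5) (by
      linarith [strictMonoOn_slope ⟨htpos, ht.2.le⟩ ⟨htpos.trans hx.1, hx.2⟩ hx.1])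
  have hanti : StrictAntiOn (phi p) (Ioc 0 t) := by
    refine strictAntiOn_of_deriv_neg (convex_Ioc _ _)
      (fun x hx => (hasDerivAt_phi p hx.1).continuousAt.continuousWithinAt) fun x hx => ?_
    rw [interior_Ioc] at hx
    rw [(hasDerivAt_phi p hx.1).deriv]
    exact hneg x hx
  have hmono : StrictMonoOn (phi p) (Icc t (Real.pi / 2)) := by
    refine strictMonoOn_of_deriv_pos (convex_Icc _ _)
      (fun x hx => (hasDerivAt_phi p (htpos.trans_le hx.1)).continuousAt.continuousWithinAt)
      fun x hx => ?_
    rw [interior_Icc] at hx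
    rw [(hasDerivAt_phi p (htpos.trans hx.1)).deriv]
    exact hpos x ⟨hx.1, hx.2.le⟩
  have hle : ∀ x ∈ Ioc 0 t, phi p x ≤ 0 := by
    intro x hx
    refine ge_of_tendsto (tendsto_phi_zero p) ?_
    filter_upwards [Ioo_mem_nhdsGT hx.1] with y hy
    exact hanti.antitoneOn ⟨hy.1, hy.2.le.trans hx.2⟩ hx hy.2.le
  refine ⟨t, ⟨⟨htpos, ht.2⟩, fun x hx => ?_, fun s hs hext => ?_⟩, ?_, fun x hx => ?_⟩
  · rcases le_total x t with h | h
    · exact hanti.antitoneOn ⟨hx.1, h⟩ ⟨htpos, le_rfl⟩ h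
    · exact hmono.monotoneOn ⟨le_rfl, ht.2.le⟩ ⟨h, hx.2.le⟩ h
  · have h := hext.hasDerivAt_eq_zero (hasDerivAt_phi p hs.1)
    rcases lt_trichotomy s t with h' | h' | h'
    · exact absurd h (hneg s ⟨hs.1, h'⟩).ne
    · exact h'
    · exact absurd h (hpos s ⟨h', hs.2.le⟩).ne'
  · exact (hanti ⟨half_pos htpos, (half_lt_self htpos).le⟩ ⟨htpos, le_rfl⟩
      (half_lt_self htpos)).trans_le (hle _ ⟨half_pos htpos, (half_lt_self htpos).le⟩)
  · rcases le_total x t with h | h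
    -- On the falling branch `φ_p ≤ 0`, while `A < p` makes the endpoint value nonnegative.
    · refine (hle x ⟨hx.1, h⟩).trans ?_
      rw [phi_pi_div_two]
      exact mul_nonneg (sub_nonneg.2 hp.1.le) (by positivity)
    · exact hmono.monotoneOn ⟨h, hx.2.le⟩ ⟨ht.2.le, le_rfl⟩ hx.2.le

/-! ### Numerical bracketing of `p₀` -/

theorem phi_pi_div_two_bounds :
    0.000014887 < phi 0.0002523411 (Real.pi / 2) ∧
    phi 0.0002523411 (Real.pi / 2) < 0.0000148872 ∧
    0.00001488785 < phi 0.00025234115 (Real.pi / 2) ∧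
    phi 0.00025234115 (Real.pi / 2) < 0.000014888 := by
  have hpi := Real.pi_pos
  have e : ∀ p, phi p (Real.pi / 2) =
      -(2 / Real.pi) + 2 / 3 - Real.pi ^ 4 / 2880 + p * (Real.pi ^ 6 / 64) := by
    intro p
    unfold phi
    rw [Real.sin_pi_div_two, Real.cos_pi_div_two]
    field_simp
    ring
  have h4 := pi_pow_bounds 4
  have h6 := pi_pow_bounds 6
  have hi1 : 2 / Real.pi ≤ 2 / 3.14159265358979323846 :=
    div_le_div_of_nonneg_left (by norm_num) (by norm_num) Real.pi_gt_d20.le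
  have hi2 : 2 / 3.14159265358979323847 ≤ 2 / Real.pi :=
    div_le_div_of_nonneg_left (by norm_num) hpi Real.pi_lt_d20.le
  simp only [e]
  norm_num at h4 h6 hi1 hi2 ⊢
  refine ⟨?_, ?_, ?_, ?_⟩ <;> linarith

/-- Bounding the minimum from above takes only one trial point, chosen near the minimizer. -/
theorem phi_lt_near_minimum :
    phi 0.0002523411 1.305656 < -0.0000148875 := by
  have hs := (cos_sin_taylor_alternating 7).2 1.305656 (by norm_num)
  have hc := (cos_sin_taylor_alternating 8).1 1.305656 (by norm_num)
  simp only [Finset.sum_range_succ, Finset.sum_range_zero, Nat.factorial] at hs hc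
  unfold phi
  norm_num at hs hc ⊢
  linarith

theorem lt_phi {x : ℝ} (hx : 0 < x) (hx' : x < Real.pi / 2) :
    -0.00001488785 < phi 0.00025234115 x := by
  have hs := (cos_sin_taylor_alternating 8).2 x hx.le
  have hc := (cos_sin_taylor_alternating 7).1 x hx.le
  simp only [Finset.sum_range_succ, Finset.sum_range_zero, Nat.factorial] at hs hc
  norm_num at hs hc
  have hx2 : x ^ 2 ≤ 2.4675 := by nlinarith [Real.pi_lt_d4]
  -- These bounds absorb the rounding in the factorization below and the leftover `x¹⁶` term.
  have hpow : ∀ k : ℕ, 0 < x ^ (2 * k) ∧ x ^ (2 * k) ≤ 2.4675 ^ k := fun k => by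
    rw [pow_mul]
    exact ⟨by positivity, pow_le_pow_left₀ (sq_nonneg x) hx2 k⟩
  have hsinc : Real.sin x / x ≤ 1 - x ^ 2 / 6 + x ^ 4 / 120 - x ^ 6 / 5040 + x ^ 8 / 362880
      - x ^ 10 / 39916800 + x ^ 12 / 6227020800 - x ^ 14 / 1307674368000
      + x ^ 16 / 355687428096000 := by
    rw [div_le_iff₀ hx]
    linarith
  have h1 := hpow 1
  have h2 := hpow 2
  have h3 := hpow 3
  have h4 := hpow 4
  have h5 := hpow 5
  have h6 := hpow 6
  have h7 := hpow 7
  have h8 := hpow 8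
  norm_num at h1 h2 h3 h4 h5 h6 h7 h8
  -- The Taylor polynomial is a tiny positive constant plus a square times a positive factor.
  have hfactor : 0 ≤ 0.00000512281464 + 0.0000060100988 * x ^ 2 + 0.0000052882983 * x ^ 4
      - 0.000000065007252 * x ^ 6 + 0.00000000052484784 * x ^ 8
      - 0.0000000000030684511 * x ^ 10 := by
    have : x ^ 6 ≤ x ^ 4 * 2.4675 := by nlinarith
    linarith
  have hsquare := mul_nonneg (sq_nonneg (x ^ 2 - 1.704735)) hfactor
  -- 1.704735 approximates the square of the minimizer, so the square nearly vanishes where the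
  -- bound is tight.
  unfold phi
  linarith

/-! ### Equioscillation and optimality -/

theorem error_phi_ge {p x : ℝ} (hx : x ∈ Ioo 0 (Real.pi / 2)) :
    ((|phi p x| : ℝ) : EReal) ≤ error (phi p) 0 (Real.pi / 2) :=
  le_iSup₂_of_le (f := fun x (_ : x ∈ Ioo 0 (Real.pi / 2)) => ((|phi p x| : ℝ) : EReal))
    x hx le_rfl

theorem error_phi_ge_pi_div_two (p : ℝ) :
    ((|phi p (Real.pi / 2)| : ℝ) : EReal) ≤ error (phi p) 0 (Real.pi / 2) := by
  have h : Tendsto (fun x => ((|phi p x| : ℝ) : EReal)) (𝓝[<] (Real.pi / 2))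
      (𝓝 ((|phi p (Real.pi / 2)| : ℝ) : EReal)) :=
    (continuous_coe_real_ereal.tendsto _).comp (leftLim_phi p).1.abs
  refine le_of_tendsto h ?_
  filter_upwards [Ioo_mem_nhdsLT Real.pi_div_two_pos] with x hx
  exact error_phi_ge hx

theorem error_eq_of_equioscillation {p t : ℝ} (ht : t ∈ Ioo 0 (Real.pi / 2))
    (hmin : IsMinOn (phi p) (Ioo 0 (Real.pi / 2)) t)
    (hmax : ∀ x ∈ Ioo 0 (Real.pi / 2), phi p x ≤ phi p (Real.pi / 2))
    (heq : |phi p t| = phi p (Real.pi / 2)) :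
    error (phi p) 0 (Real.pi / 2) = ((|phi p t| : ℝ) : EReal) := by
  refine le_antisymm (iSup₂_le fun x hx => EReal.coe_le_coe_iff.2 (abs_le.2 ⟨?_, ?_⟩))
    (error_phi_ge ht)
  · exact (neg_abs_le _).trans (hmin hx)
  · exact heq ▸ hmax x hx

theorem error_lt_of_equioscillation {p q t : ℝ} (hpq : q ≠ p) (ht : t ∈ Ioo 0 (Real.pi / 2))
    (hneg : phi p t < 0) (heq : |phi p t| = phi p (Real.pi / 2)) :
    ((|phi p t| : ℝ) : EReal) < error (phi q) 0 (Real.pi / 2) := by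
  rcases lt_or_gt_of_ne hpq with h | h
  · refine lt_of_lt_of_le (EReal.coe_lt_coe_iff.2 ?_) (error_phi_ge ht)
    have h' : phi q t < phi p t := by
      rw [phi_sub_phi p q t]
      have := mul_pos (sub_pos.2 h) (pow_pos ht.1 6)
      linarith
    rw [abs_of_neg hneg, abs_of_neg (h'.trans hneg)]
    linarith
  · refine lt_of_lt_of_le (EReal.coe_lt_coe_iff.2 ?_) (error_phi_ge_pi_div_two q)
    refine lt_of_lt_of_le ?_ (le_abs_self _)
    rw [heq, phi_sub_phi p q]
    have := mul_pos (sub_pos.2 h) (pow_pos Real.pi_div_two_pos 6)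
    linarith

/-! ### Dependence of the minimum on the parameter -/

/-- Comparing at the other parameter's minimizer gives the Lipschitz constant `(π/2)⁶`; no
continuity of `t` is needed. -/
theorem continuousOn_minimum {s : Set ℝ} {t : ℝ → ℝ}
    (ht : ∀ p ∈ s, t p ∈ Ioo 0 (Real.pi / 2) ∧ IsMinOn (phi p) (Ioo 0 (Real.pi / 2)) (t p)) :
    ContinuousOn (fun p => phi p (t p)) s := by
  refine (LipschitzOnWith.of_le_add_mul ((Real.pi / 2) ^ 6).toNNReal
    fun p hp q hq => ?_).continuousOn
  rw [Real.coe_toNNReal _ (by positivity)]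
  have hq' := (ht q hq).1
  calc phi p (t p) ≤ phi p (t q) := (ht p hp).2 hq'
    _ = phi q (t q) + (p - q) * t q ^ 6 := phi_sub_phi q p _
    _ ≤ phi q (t q) + dist p q * t q ^ 6 := by
      gcongr
      exact le_abs_self _
    _ ≤ phi q (t q) + dist p q * (Real.pi / 2) ^ 6 := by
      gcongr
      exacts [hq'.1.le, hq'.2.le]
    _ = _ := by ring

theorem strictMonoOn_minimum {s : Set ℝ} {t : ℝ → ℝ}
    (ht : ∀ p ∈ s, t p ∈ Ioo 0 (Real.pi / 2) ∧ IsMinOn (phi p) (Ioo 0 (Real.pi / 2)) (t p)) :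
    StrictMonoOn (fun p => phi p (t p)) s := by
  intro p hp q hq hpq
  have hq' := (ht q hq).1
  have := mul_pos (sub_pos.2 hpq) (pow_pos hq'.1 6)
  calc phi p (t p) ≤ phi p (t q) := (ht p hp).2 hq'
    _ < phi p (t q) + (q - p) * t q ^ 6 := by linarith
    _ = phi q (t q) := (phi_sub_phi p q _).symm

theorem strictMono_phi_pi_div_two : StrictMono fun p => phi p (Real.pi / 2) := by
  intro p q hpq
  have := mul_pos (sub_pos.2 hpq) (pow_pos Real.pi_div_two_pos 6)
  simp only [phi_pi_div_two]
  linarith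

end CusaHuygens

theorem mainTheorem8 :
    -- numerical values of the end points of the parameter interval
    (0.00025135 ≤ CusaHuygens.A ∧ CusaHuygens.A < 0.00025136) ∧
    (0.00026455 ≤ CusaHuygens.B ∧ CusaHuygens.B < 0.00026456) ∧
    -- the minimum point `t p` and the left limit at `π / 2` are well defined
    ∃ t : ℝ → ℝ,
      (∀ p ∈ Ioo CusaHuygens.A CusaHuygens.B,
        CusaHuygens.IsSoleMinimum (CusaHuygens.phi p) 0 (Real.pi / 2) (t p) ∧
        Tendsto (CusaHuygens.phi p) (𝓝[<] (Real.pi / 2))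
          (𝓝 (Function.leftLim (CusaHuygens.phi p) (Real.pi / 2)))) ∧
      ∃ p₀ ∈ Ioo CusaHuygens.A CusaHuygens.B, ∃ d₀ : ℝ,
        -- `p₀` is the only solution of the equation in `(A, B)`
        (∀ p ∈ Ioo CusaHuygens.A CusaHuygens.B,
          |CusaHuygens.phi p (t p)| = Function.leftLim (CusaHuygens.phi p) (Real.pi / 2) ↔
            p = p₀) ∧
        (0.00025234 ≤ p₀ ∧ p₀ < 0.00025235) ∧
        -- the value `d₀` and its minimax property
        d₀ = |CusaHuygens.phi p₀ (t p₀)| ∧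
        d₀ = Function.leftLim (CusaHuygens.phi p₀) (Real.pi / 2) ∧
        (0.000014887 ≤ d₀ ∧ d₀ < 0.000014888) ∧
        (d₀ : EReal) = CusaHuygens.minimaxError CusaHuygens.phi 0 (Real.pi / 2) ∧
        -- the minimax approximant and the corresponding minimax approximation
        CusaHuygens.IsMinimaxApproximant CusaHuygens.phi 0 (Real.pi / 2) p₀ ∧
        CusaHuygens.error
          (fun x => (Real.sin x / x - (Real.cos x + 2) / 3) - (-(1 / 180) * x ^ 4 + p₀ * x ^ 6))
          0 (Real.pi / 2) = (d₀ : EReal) := by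
  open CusaHuygens in
  have hA := A_bounds
  have hA1 := hA.1
  have hA2 := hA.2
  have hB1 : 0.00026455 ≤ B := by norm_num [B]
  have hB2 : B < 0.00026456 := by norm_num [B]
  norm_num at hA1 hA2 hB1 hB2
  refine ⟨⟨by linarith, by linarith⟩, ⟨by linarith, by linarith⟩, ?_⟩
  choose! t ht using fun p (hp : p ∈ Ioo A B) => exists_isSoleMinimum hp
  have htmin : ∀ p ∈ Ioo A B,
      t p ∈ Ioo 0 (Real.pi / 2) ∧ IsMinOn (phi p) (Ioo 0 (Real.pi / 2)) (t p) :=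
    fun p hp => ⟨(ht p hp).1.1, (ht p hp).1.2.1⟩
  have hmono : StrictMonoOn (fun p => phi p (t p) + phi p (Real.pi / 2)) (Ioo A B) :=
    (strictMonoOn_minimum htmin).add (strictMono_phi_pi_div_two.strictMonoOn _)
  have hcont : ContinuousOn (fun p => phi p (t p) + phi p (Real.pi / 2)) (Ioo A B) := by
    refine (continuousOn_minimum htmin).add ?_
    simp only [phi_pi_div_two]
    fun_prop
  obtain ⟨hM1, hM2, hM3, hM4⟩ := phi_pi_div_two_bounds
  have hsub : Icc (0.0002523411 : ℝ) 0.00025234115 ⊆ Ioo A B := fun p hp => by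
    have h1 := hp.1
    have h2 := hp.2
    norm_num at h1 h2
    exact ⟨by linarith, by linarith⟩
  have hlow := hsub (left_mem_Icc.2 (by norm_num))
  have hhigh := hsub (right_mem_Icc.2 (by norm_num))
  -- As the minimum is negative, a zero of the sum is exactly a solution of the equation.
  obtain ⟨p₀, hp₀, hzero⟩ := intermediate_value_Ioo (by norm_num) (hcont.mono hsub)
    (show (0 : ℝ) ∈ _ from ⟨by
      have h := (htmin _ hlow).2 (show (1.305656 : ℝ) ∈ Ioo 0 (Real.pi / 2) from
        ⟨by norm_num, by linarith [Real.pi_gt_d2]⟩)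
      have h' := phi_lt_near_minimum
      simp only [mem_ofPred_eq] at h
      linarith, by
      have h := lt_phi (htmin _ hhigh).1.1 (htmin _ hhigh).1.2
      linarith⟩)
  simp only at hzero
  have hp₀' := hsub (Ioo_subset_Icc_self hp₀)
  obtain ⟨⟨htp, hmin, -⟩, hneg, hmax⟩ := ht p₀ hp₀'
  have heq : |phi p₀ (t p₀)| = phi p₀ (Real.pi / 2) := by
    rw [abs_of_neg hneg]
    linarith
  have herr := error_eq_of_equioscillation htp hmin hmax heq
  have hpos : 0 < p₀ := by linarith [hp₀'.1]
  have hminimax : ((|phi p₀ (t p₀)| : ℝ) : EReal) = minimaxError phi 0 (Real.pi / 2) := by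
    refine le_antisymm (le_iInf₂ fun q _ => ?_) (herr ▸ iInf₂_le p₀ hpos)
    rcases eq_or_ne q p₀ with rfl | hq
    · exact herr.ge
    · exact (error_lt_of_equioscillation hq htp hneg heq).le
  have hp1 := hp₀.1
  have hp2 := hp₀.2
  norm_num at hp1 hp2
  refine ⟨t, fun p hp => ⟨(ht p hp).1, ?_⟩, p₀, hp₀', |phi p₀ (t p₀)|, fun p hp => ?_,
    ⟨by linarith, by linarith⟩, rfl, ?_, ⟨?_, ?_⟩, hminimax,
    ⟨hpos, herr.trans hminimax, fun q _ hq => ?_⟩, ?_⟩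
  · rw [(leftLim_phi p).2]
    exact (leftLim_phi p).1
  · rw [(leftLim_phi p).2, abs_of_neg (ht p hp).2.1]
    refine ⟨fun h => hmono.injOn hp hp₀' ?_, ?_⟩
    · linarith
    · rintro rfl
      linarith
  · rw [(leftLim_phi p₀).2, heq]
  · rw [heq]
    exact hM1.le.trans (strictMono_phi_pi_div_two hp₀.1).le
  · rw [heq]
    exact (strictMono_phi_pi_div_two hp₀.2).trans hM4
  · by_contra hne
    exact (error_lt_of_equioscillation hne htp hneg heq).ne (hminimax.trans hq.symm)
  · rw [← herr]
    unfold error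
    refine iSup_congr fun x => iSup_congr fun _ => ?_
    rw [← abs_neg (phi p₀ x)]
    congr 2
    unfold phi
    ring
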